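/- Rings are associative but need not have an identity. A ring $R$ is called $s$-unital if $r\in Rr$ and $r\in rR$ for every $r\in R$, and a ring $S$ is called prime if there are no nonzero two-sided ideals $I,J$ of $S$ with $IJ=\{0\}$. A groupoid $G$ is a small category in which every morphism is invertible; $G_0$ is its set of objects, and for $e\in G_0$ the isotropy group $G_e^e$ is the group of all morphisms from $e$ to $e$. The groupoid $G$ is connected if for all $e,f\in G_0$ there is a morphism from $e$ to $f$. The groupoid ring $R[G]$ consists of the finite formal sums $\sum_g a_g\delta_g$ with $a_g\in R$ and $g$ running through the morphisms of $G$, with the biadditive multiplication determined by $a\delta_g\cdot b\delta_h=ab\,\delta_{gh}$ if $g,h$ are composable, and $0$ otherwise; for a group this is the group ring. Let $R$ be a nonzero $s$-unital ring and let $G$ be a non-empty groupoid. The following assertions are equivalent: (i) the groupoid ring $R[G]$ is prime; (ii) $G$ is connected and there is some $e\in G_0$ such that $R[G_e^e]$ is prime; (iii) $G$ is connected and, for every $e\in G_0$, $R[G_e^e]$ is prime; (iv) $G$ is connected, $R$ is prime, and there is some $e\in G_0$ such that $G_e^e$ has no non-trivial finite normal subgroup; (v) $G$ is connected, $R$ is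 prime and, for every $e\in G_0$, $G_e^e$ has no non-trivial finite normal subgroup. -/

import Mathlib

open CategoryTheory

universe u v w

/-- A (not necessarily unital) ring `R` is `s`-unital if `r ∈ R r` and `r ∈ r R` for all `r`. -/
def IsSUnitalRing (R : Type*) [NonUnitalRing R] : Prop :=
  ∀ r : R, (∃ a : R, a * r = r) ∧ (∃ b : R, r * b = r)

/-- A (not necessarily unital) ring `S` is prime if there are no nonzero two-sided ideals `I`, `J`
with `I J = 0`. (The ideal `I J` consists of the finite sums of products `a * b` with `a ∈ I` and
`b ∈ J`, so it is zero exactly when all these products are.) -/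
def IsPrimeNonUnitalRing (S : Type*) [NonUnitalRing S] : Prop :=
  ¬ ∃ I J : TwoSidedIdeal S, I ≠ ⊥ ∧ J ≠ ⊥ ∧ ∀ a ∈ I, ∀ b ∈ J, a * b = 0

/-- A groupoid is connected if there is a morphism between any two objects. -/
def GroupoidConnected (G : Type u) [Groupoid.{v} G] : Prop :=
  ∀ e f : G, Nonempty (e ⟶ f)

/-- A group has no non-trivial finite normal subgroup. -/
def NoNontrivialFiniteNormalSubgroup (H : Type*) [Group H] : Prop :=
  ∀ N : Subgroup H, N.Normal → Finite N → N = ⊥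

noncomputable section

/-- The set of all morphisms of a groupoid. -/
structure GroupoidMor (G : Type u) [Groupoid.{v} G] where
  /-- The source (domain). -/
  s : G
  /-- The range (codomain). -/
  r : G
  /-- The morphism itself. -/
  hom : s ⟶ r

namespace GroupoidMor

variable {G : Type u} [Groupoid.{v} G]

/-- The product `g h` ("first `h`, then `g`") of a composable pair, that is, `s(g) = r(h)`. -/
def comp (g h : GroupoidMor G) (p : g.s = h.r) : GroupoidMor G :=
  ⟨h.s, g.r, h.hom ≫ eqToHom p.symm ≫ g.hom⟩

theorem comp_assoc (g h k : GroupoidMor G) (p : g.s = h.r) (q : h.s = k.r) :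
    (g.comp h p).comp k q = g.comp (h.comp k q) p := by
  simp [comp]

end GroupoidMor

/-- The groupoid ring `R[G]`: finite formal sums `∑ a_g δ_g` over the morphisms `g` of `G`. -/
def GroupoidRing (R : Type w) [NonUnitalRing R] (G : Type u) [Groupoid.{v} G] :
    Type (max u v w) :=
  GroupoidMor G →₀ R

namespace GroupoidRing

variable {R : Type w} [NonUnitalRing R] {G : Type u} [Groupoid.{v} G]

instance : AddCommGroup (GroupoidRing R G) :=
  inferInstanceAs (AddCommGroup (GroupoidMor G →₀ R))

/-- The element `a δ_g`. -/
def single (g : GroupoidMor G) (a : R) : GroupoidRing R G := Finsupp.single g a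

open Classical in
/-- The product `a δ_g · b δ_h`: it is `ab δ_{gh}` if `g`, `h` are composable and `0` otherwise. -/
def mulSingle (g h : GroupoidMor G) (a b : R) : GroupoidRing R G :=
  if p : g.s = h.r then single (g.comp h p) (a * b) else 0

/-- The biadditive extension of `a δ_g · b δ_h`. -/
instance : Mul (GroupoidRing R G) :=
  ⟨fun x y => Finsupp.sum x fun g a => Finsupp.sum y fun h b => mulSingle g h a b⟩

theorem single_zero (g : GroupoidMor G) : single g (0 : R) = 0 := Finsupp.single_zero g

theorem single_add (g : GroupoidMor G) (a b : R) :
    single g (a + b) = single g a + single g b := Finsupp.single_add g a b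

theorem mulSingle_zero_left (g h : GroupoidMor G) (b : R) : mulSingle g h 0 b = 0 := by
  unfold mulSingle; split_ifs <;> simp [single_zero]

theorem mulSingle_zero_right (g h : GroupoidMor G) (a : R) : mulSingle g h a 0 = 0 := by
  unfold mulSingle; split_ifs <;> simp [single_zero]

theorem mulSingle_add_left (g h : GroupoidMor G) (a a' b : R) :
    mulSingle g h (a + a') b = mulSingle g h a b + mulSingle g h a' b := by
  unfold mulSingle; split_ifs <;> simp [add_mul, single_add]

theorem mulSingle_add_right (g h : GroupoidMor G) (a b b' : R) :
    mulSingle g h a (b + b') = mulSingle g h a b + mulSingle g h a b' := by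
  unfold mulSingle; split_ifs <;> simp [mul_add, single_add]

theorem mul_def (x y : GroupoidRing R G) :
    x * y = Finsupp.sum x fun g a => Finsupp.sum y fun h b => mulSingle g h a b := rfl

protected theorem zero_mul (x : GroupoidRing R G) : 0 * x = 0 := Finsupp.sum_zero_index

protected theorem mul_zero (x : GroupoidRing R G) : x * 0 = 0 :=
  Finset.sum_eq_zero fun _ _ => Finsupp.sum_zero_index

protected theorem add_mul (x y z : GroupoidRing R G) : (x + y) * z = x * z + y * z := by
  classical
  refine Finsupp.sum_add_index' (fun g => ?_) (fun g a a' => ?_)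
  · exact Finset.sum_eq_zero fun h _ => mulSingle_zero_left g h _
  · exact (Finset.sum_congr rfl fun h _ => mulSingle_add_left g h a a' _).trans
      Finset.sum_add_distrib

protected theorem mul_add (x y z : GroupoidRing R G) : x * (y + z) = x * y + x * z := by
  classical
  refine (Finset.sum_congr rfl fun g _ => ?_).trans Finset.sum_add_distrib
  exact Finsupp.sum_add_index' (fun h => mulSingle_zero_right g h _)
    (fun h b b' => mulSingle_add_right g h _ b b')

theorem single_mul_single (g h : GroupoidMor G) (a b : R) :
    single g a * single h b = mulSingle g h a b := by
  refine (Finsupp.sum_single_index ?_).trans (Finsupp.sum_single_index ?_)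
  · exact Finset.sum_eq_zero fun k _ => mulSingle_zero_left g k _
  · exact mulSingle_zero_right g h a

theorem single_mul_single_of_eq (g h : GroupoidMor G) (p : g.s = h.r) (a b : R) :
    single g a * single h b = single (g.comp h p) (a * b) := by
  rw [single_mul_single, mulSingle, dif_pos p]

theorem single_mul_single_of_ne (g h : GroupoidMor G) (p : ¬ g.s = h.r) (a b : R) :
    single g a * single h b = 0 := by
  rw [single_mul_single, mulSingle, dif_neg p]

protected theorem induction {P : GroupoidRing R G → Prop} (x : GroupoidRing R G) (h0 : P 0)
    (hadd : ∀ y z, P y → P z → P (y + z)) (hs : ∀ g a, P (single g a)) : P x :=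
  Finsupp.induction_linear x h0 hadd hs

protected theorem mul_assoc (x y z : GroupoidRing R G) : x * y * z = x * (y * z) := by
  induction x using GroupoidRing.induction with
  | h0 => simp only [GroupoidRing.zero_mul]
  | hadd x x' hx hx' => simp only [GroupoidRing.add_mul, hx, hx']
  | hs g a =>
  induction y using GroupoidRing.induction with
  | h0 => simp only [GroupoidRing.zero_mul, GroupoidRing.mul_zero]
  | hadd y y' hy hy' => simp only [GroupoidRing.add_mul, GroupoidRing.mul_add, hy, hy']
  | hs h b =>
  induction z using GroupoidRing.induction with
  | h0 => simp only [GroupoidRing.mul_zero]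
  | hadd z z' hz hz' => simp only [GroupoidRing.mul_add, hz, hz']
  | hs k c =>
  by_cases p : g.s = h.r
  · by_cases q : h.s = k.r
    · rw [single_mul_single_of_eq g h p, single_mul_single_of_eq h k q,
        single_mul_single_of_eq (g.comp h p) k q, single_mul_single_of_eq g (h.comp k q) p,
        GroupoidMor.comp_assoc, mul_assoc]
    · rw [single_mul_single_of_eq g h p, single_mul_single_of_ne h k q,
        single_mul_single_of_ne (g.comp h p) k q, GroupoidRing.mul_zero]
  · by_cases q : h.s = k.r
    · rw [single_mul_single_of_ne g h p, single_mul_single_of_eq h k q,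
        single_mul_single_of_ne g (h.comp k q) p, GroupoidRing.zero_mul]
    · rw [single_mul_single_of_ne g h p, single_mul_single_of_ne h k q,
        GroupoidRing.zero_mul, GroupoidRing.mul_zero]

instance : NonUnitalRing (GroupoidRing R G) where
  left_distrib := GroupoidRing.mul_add
  right_distrib := GroupoidRing.add_mul
  zero_mul := GroupoidRing.zero_mul
  mul_zero := GroupoidRing.mul_zero
  mul_assoc := GroupoidRing.mul_assoc

end GroupoidRing

/-- The group ring `R[H]` of a group `H` over a (not necessarily unital) ring `R`: finite formal
sums `∑ a_h δ_h` over the elements `h` of `H`. (`MonoidAlgebra` needs unital coefficients.) -/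
def NonUnitalGroupRing (R : Type w) [NonUnitalRing R] (H : Type v) [Group H] : Type (max v w) :=
  H →₀ R

namespace NonUnitalGroupRing

variable {R : Type w} [NonUnitalRing R] {H : Type v} [Group H]

instance : AddCommGroup (NonUnitalGroupRing R H) :=
  inferInstanceAs (AddCommGroup (H →₀ R))

/-- The element `a δ_h`. -/
def single (h : H) (a : R) : NonUnitalGroupRing R H := Finsupp.single h a

/-- The biadditive extension of `a δ_g · b δ_h = ab δ_{gh}`. -/
instance : Mul (NonUnitalGroupRing R H) :=
  ⟨fun x y => Finsupp.sum x fun g a => Finsupp.sum y fun h b => single (g * h) (a * b)⟩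

theorem single_zero (h : H) : single h (0 : R) = 0 := Finsupp.single_zero h

theorem single_add (h : H) (a b : R) :
    single h (a + b) = single h a + single h b := Finsupp.single_add h a b

theorem mul_def (x y : NonUnitalGroupRing R H) :
    x * y = Finsupp.sum x fun g a => Finsupp.sum y fun h b => single (g * h) (a * b) := rfl

protected theorem zero_mul (x : NonUnitalGroupRing R H) : 0 * x = 0 := Finsupp.sum_zero_index

protected theorem mul_zero (x : NonUnitalGroupRing R H) : x * 0 = 0 :=
  Finset.sum_eq_zero fun _ _ => Finsupp.sum_zero_index

protected theorem add_mul (x y z : NonUnitalGroupRing R H) : (x + y) * z = x * z + y * z := by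
  classical
  refine Finsupp.sum_add_index' (fun g => ?_) (fun g a a' => ?_)
  · exact Finset.sum_eq_zero fun h _ => by simp only [zero_mul, single_zero]
  · exact (Finset.sum_congr rfl fun h _ => by simp only [add_mul, single_add]).trans
      Finset.sum_add_distrib

protected theorem mul_add (x y z : NonUnitalGroupRing R H) : x * (y + z) = x * y + x * z := by
  classical
  refine (Finset.sum_congr rfl fun g _ => ?_).trans Finset.sum_add_distrib
  exact Finsupp.sum_add_index' (fun h => by simp only [mul_zero, single_zero])
    (fun h b b' => by simp only [mul_add, single_add])

theorem single_mul_single (g h : H) (a b : R) :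
    single g a * single h b = single (g * h) (a * b) := by
  refine (Finsupp.sum_single_index ?_).trans (Finsupp.sum_single_index ?_)
  · exact Finset.sum_eq_zero fun k _ => by simp only [zero_mul, single_zero]
  · simp only [mul_zero, single_zero]

protected theorem induction {P : NonUnitalGroupRing R H → Prop} (x : NonUnitalGroupRing R H)
    (h0 : P 0) (hadd : ∀ y z, P y → P z → P (y + z)) (hs : ∀ h a, P (single h a)) : P x :=
  Finsupp.induction_linear x h0 hadd hs

protected theorem mul_assoc (x y z : NonUnitalGroupRing R H) : x * y * z = x * (y * z) := by
  induction x using NonUnitalGroupRing.induction with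
  | h0 => simp only [NonUnitalGroupRing.zero_mul]
  | hadd x x' hx hx' => simp only [NonUnitalGroupRing.add_mul, hx, hx']
  | hs g a =>
  induction y using NonUnitalGroupRing.induction with
  | h0 => simp only [NonUnitalGroupRing.zero_mul, NonUnitalGroupRing.mul_zero]
  | hadd y y' hy hy' =>
    simp only [NonUnitalGroupRing.add_mul, NonUnitalGroupRing.mul_add, hy, hy']
  | hs h b =>
  induction z using NonUnitalGroupRing.induction with
  | h0 => simp only [NonUnitalGroupRing.mul_zero]
  | hadd z z' hz hz' => simp only [NonUnitalGroupRing.mul_add, hz, hz']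
  | hs k c => simp only [single_mul_single, mul_assoc]

instance : NonUnitalRing (NonUnitalGroupRing R H) where
  left_distrib := NonUnitalGroupRing.mul_add
  right_distrib := NonUnitalGroupRing.add_mul
  zero_mul := NonUnitalGroupRing.zero_mul
  mul_zero := NonUnitalGroupRing.mul_zero
  mul_assoc := NonUnitalGroupRing.mul_assoc

end NonUnitalGroupRing

end

/-- The isotropy group `G_e^e` of all morphisms from `e` to `e`, with the product `g h` being
"first `h`, then `g`". -/
abbrev Isotropy {G : Type u} [Groupoid.{v} G] (e : G) : Type v := End e

/-! The ring of an isotropy group sits in `R[G]` as a corner. Over a connected groupoid, every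
nonzero element can be multiplied on both sides into a nonzero element of that corner, so primeness
passes between `R[G]` and `R[G_e^e]`. If there is no morphism from `e` to `f`, then `a δ_f` and `a
δ_e` (at identities) annihilate each other through all of `R[G]`, so primeness forces connectedness.

What remains is Connell's theorem for s-unital coefficients, `NonUnitalGroupRing.isPrime_iff`. A
finite normal subgroup `N` with `1 ≠ n ∈ N` spoils primeness through `∑_{m ∈ N} r δ_m` and `r δ_1 -
r δ_n`. Conversely, suppose `α R[H] β = 0`. Neumann's lemma on coset coverings gives Passman's
reduction `sum_fcCenter_eq_zero`: the relation persists when only left factors from the FC-center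
are kept. Without finite normal subgroups, the theorems of Schur and Dietzmann make the FC-center
torsion-free abelian, so it has unique products. A uniquely represented product isolates nonzero
coefficients `a`, `b` with `a R b = 0`, against primeness of `R`.

Local units replace the identity throughout. -/

/-! ### The FC-center and finite normal subgroups. -/

section FCCenter

open scoped Pointwise commutatorElement

variable (H : Type*) [Group H]

/-- The subgroup of all elements with finitely many conjugates, that is, of all elements whose
centralizer has finite index. -/
def fcCenter : Subgroup H where
  carrier := {g | (Subgroup.centralizer {g}).FiniteIndex}
  one_mem' := by
    have : Subgroup.centralizer {(1 : H)} = ⊤ := by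
      ext x; simp [Subgroup.mem_centralizer_singleton_iff]
    simp only [Set.mem_ofPred_eq, this]
    infer_instance
  mul_mem' := by
    intro a b (ha : Subgroup.FiniteIndex _) (hb : Subgroup.FiniteIndex _)
    refine Subgroup.finiteIndex_of_le
      (H := Subgroup.centralizer {a} ⊓ Subgroup.centralizer {b}) ?_
    rintro x ⟨hxa, hxb⟩
    rw [Subgroup.mem_centralizer_singleton_iff]
    exact Commute.mul_right (Subgroup.mem_centralizer_singleton_iff.1 hxa)
      (Subgroup.mem_centralizer_singleton_iff.1 hxb)
  inv_mem' := by
    intro a (ha : Subgroup.FiniteIndex _)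
    refine Subgroup.finiteIndex_of_le (H := Subgroup.centralizer {a}) fun x hx => ?_
    rw [Subgroup.mem_centralizer_singleton_iff] at *
    exact (Commute.inv_right (show Commute x a from hx))

variable {H}

theorem mem_fcCenter {g : H} : g ∈ fcCenter H ↔ (Subgroup.centralizer {g}).FiniteIndex := Iff.rfl

theorem finite_conjugatesOf_of_mem_fcCenter {g : H} (hg : g ∈ fcCenter H) :
    (conjugatesOf g).Finite := by
  have := mem_fcCenter.1 hg
  refine (Set.finite_range fun q : H ⧸ Subgroup.centralizer {g} => q.out * g * q.out⁻¹).subset ?_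
  intro y hy
  obtain ⟨c, rfl⟩ := isConj_iff.1 (show IsConj _ _ from hy)
  refine ⟨(c : H ⧸ Subgroup.centralizer {g}), ?_⟩
  obtain ⟨z, hz⟩ := QuotientGroup.mk_out_eq_mul (Subgroup.centralizer {g}) c
  have hzg := Subgroup.mem_centralizer_singleton_iff.1 z.2
  simp only [hz, mul_inv_rev]
  rw [mul_assoc c, hzg]
  group

theorem mem_fcCenter_of_isConj {g h : H} (hg : g ∈ fcCenter H) (hc : IsConj g h) :
    h ∈ fcCenter H := by
  obtain ⟨c, rfl⟩ := isConj_iff.1 hc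
  have := mem_fcCenter.1 hg
  rw [mem_fcCenter]
  have : ((Subgroup.centralizer {g}).comap (MulAut.conj c⁻¹).toMonoidHom).FiniteIndex := by
    constructor
    rw [Subgroup.index_comap_of_surjective _ (MulAut.conj c⁻¹).surjective]
    exact this.index_ne_zero
  refine Subgroup.finiteIndex_of_le
    (H := (Subgroup.centralizer {g}).comap (MulAut.conj c⁻¹).toMonoidHom) fun x hx => ?_
  have hx' := Subgroup.mem_centralizer_singleton_iff.1 (Subgroup.mem_comap.1 hx)
  simp only [MulEquiv.toMonoidHom_eq_coe, MonoidHom.coe_coe, MulAut.conj_apply, inv_inv] at hx'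
  rw [Subgroup.mem_centralizer_singleton_iff]
  calc x * (c * g * c⁻¹) = c * (c⁻¹ * x * c * g) * c⁻¹ := by group
    _ = c * (g * (c⁻¹ * x * c)) * c⁻¹ := by rw [hx']
    _ = c * g * c⁻¹ * x := by group

/-- A finitely generated group all of whose elements have finitely many conjugates has a finite
commutator subgroup. -/
theorem finite_commutator_of_fg [Group.FG H] (hH : fcCenter H = ⊤) : Finite (commutator H) := by
  obtain ⟨S, hS⟩ := Group.FG.out (G := H)
  -- The center is the intersection of the centralizers of the finitely many generators.
  have hZ : (Subgroup.center H).FiniteIndex := by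
    rw [Subgroup.center_eq_iInf hS]
    exact Subgroup.finiteIndex_iInf' _ fun g _ => mem_fcCenter.1 (hH ▸ Subgroup.mem_top g)
  have : Finite (commutatorSet H) := by
    -- A commutator depends only on the classes of its entries modulo the center.
    refine ((Set.finite_range fun q : (H ⧸ Subgroup.center H) × (H ⧸ Subgroup.center H) =>
      ⁅q.1.out, q.2.out⁆).subset ?_).to_subtype
    rintro _ ⟨a, b, rfl⟩
    refine ⟨(a, b), ?_⟩
    obtain ⟨y, hy⟩ := QuotientGroup.mk_out_eq_mul (Subgroup.center H) a
    obtain ⟨z, hz⟩ := QuotientGroup.mk_out_eq_mul (Subgroup.center H) b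
    have hy' := Subgroup.mem_center_iff.1 y.2
    have hz' := Subgroup.mem_center_iff.1 z.2
    simp only [hy, hz, commutatorElement_def, mul_inv_rev]
    calc a * ↑y * (b * ↑z) * ((↑y)⁻¹ * a⁻¹) * ((↑z)⁻¹ * b⁻¹)
        = a * (y * b) * (z * ((↑y)⁻¹ * a⁻¹)) * ((↑z)⁻¹ * b⁻¹) := by group
      _ = a * (b * y) * ((↑y)⁻¹ * a⁻¹ * z) * ((↑z)⁻¹ * b⁻¹) := by rw [hy', hz']
      _ = a * b * a⁻¹ * b⁻¹ := by group
  -- Schur's theorem: finitely many commutators generate a finite commutator subgroup.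
  infer_instance

theorem fcCenter_eq_top_of_le {K : Subgroup H} (hK : K ≤ fcCenter H) : fcCenter K = ⊤ := by
  refine eq_top_iff.2 fun k _ => ?_
  have := mem_fcCenter.1 (hK k.2)
  refine Subgroup.finiteIndex_of_le (H := (Subgroup.centralizer {(k : H)}).subgroupOf K) ?_
  intro x hx
  have := Subgroup.mem_centralizer_singleton_iff.1 (Subgroup.mem_subgroupOf.1 hx)
  exact Subgroup.mem_centralizer_singleton_iff.2 (Subtype.ext this)

/-- Dietzmann's lemma: an element of finite order with finitely many conjugates lies in a finite
normal subgroup. -/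
theorem finite_normalClosure_of_isOfFinOrder {g : H} (hg : g ∈ fcCenter H)
    (ho : IsOfFinOrder g) : Finite (Subgroup.normalClosure {g}) := by
  have hcl : Subgroup.normalClosure {g} = Subgroup.closure (conjugatesOf g) := by
    rw [Subgroup.normalClosure, Group.conjugatesOfSet]; simp
  rw [hcl]
  set N := Subgroup.closure (conjugatesOf g) with hN
  have hfin := finite_conjugatesOf_of_mem_fcCenter hg
  have hfg : Group.FG N := by
    rw [Group.fg_iff_subgroup_fg, Subgroup.fg_iff]
    exact ⟨_, rfl, hfin⟩
  have hNfc : N ≤ fcCenter H := (Subgroup.closure_le _).2 fun h hh =>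
    mem_fcCenter_of_isConj hg (show IsConj _ _ from hh)
  have hcomm : Finite (commutator N) := finite_commutator_of_fg (fcCenter_eq_top_of_le hNfc)
  -- The abelianization is generated by images of conjugates of `g`, all of finite order; being
  -- finitely generated as well, it is finite.
  have htors : IsMulTorsion (Abelianization N) := by
    intro x
    obtain ⟨⟨y, hy⟩, rfl⟩ := QuotientGroup.mk_surjective x
    change IsOfFinOrder (Abelianization.of (⟨y, hy⟩ : N))
    induction hy using Subgroup.closure_induction with
    | mem y hy =>
      refine MonoidHom.isOfFinOrder _ ?_
      rw [← Submonoid.isOfFinOrder_coe]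
      obtain ⟨c, rfl⟩ := isConj_iff.1 (show IsConj _ _ from hy)
      exact (MulAut.conj c).toMonoidHom.isOfFinOrder ho
    | one => exact (map_one (Abelianization.of (G := N))) ▸ IsOfFinOrder.one
    | mul a b ha hb iha ihb =>
      have : Abelianization.of (⟨a * b, mul_mem ha hb⟩ : N) =
        Abelianization.of (⟨a, ha⟩ : N) * Abelianization.of (⟨b, hb⟩ : N) := by
          rw [← map_mul]; rfl
      exact this ▸ iha.mul ihb
    | inv a ha iha =>
      have : Abelianization.of (⟨a⁻¹, inv_mem ha⟩ : N) =
        (Abelianization.of (⟨a, ha⟩ : N))⁻¹ := by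
          rw [← map_inv]; rfl
      exact this ▸ iha.inv
  have : Group.FG (Abelianization N) := QuotientGroup.fg _
  have hab : Finite (N ⧸ commutator N) := CommGroup.finite_of_fg_isMulTorsion (Abelianization N) htors
  exact (Subgroup.finite_iff_finite_and_finiteIndex (commutator N)).2
    ⟨hcomm, Subgroup.finiteIndex_of_finite_quotient⟩

theorem eq_one_of_mem_fcCenter_of_isOfFinOrder (hH : NoNontrivialFiniteNormalSubgroup H) {g : H}
    (hg : g ∈ fcCenter H) (ho : IsOfFinOrder g) : g = 1 := by
  have h := hH _ Subgroup.normalClosure_normal (finite_normalClosure_of_isOfFinOrder hg ho)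
  exact Subgroup.mem_bot.1 (h ▸ Subgroup.subset_normalClosure (Set.mem_singleton g))

/-- The commutator lies in the finite commutator subgroup of `⟨a, b⟩`, so it is an FC-element of
finite order, hence trivial by Dietzmann's lemma. -/
theorem commute_of_mem_fcCenter (hH : NoNontrivialFiniteNormalSubgroup H) {a b : H}
    (ha : a ∈ fcCenter H) (hb : b ∈ fcCenter H) : Commute a b := by
  set K := Subgroup.closure {a, b} with hKdef
  have hK : K ≤ fcCenter H := (Subgroup.closure_le _).2 (by
    rintro x (rfl | rfl) <;> assumption)
  have haK : a ∈ K := Subgroup.subset_closure (by simp)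
  have hbK : b ∈ K := Subgroup.subset_closure (by simp)
  have hfg : Group.FG K := by
    rw [Group.fg_iff_subgroup_fg, Subgroup.fg_iff]
    exact ⟨_, rfl, Set.toFinite _⟩
  have hfin : Finite (commutator K) := finite_commutator_of_fg (fcCenter_eq_top_of_le hK)
  have hmem : ⁅(⟨a, haK⟩ : K), (⟨b, hbK⟩ : K)⁆ ∈ commutator K :=
    Subgroup.commutator_mem_commutator (Subgroup.mem_top _) (Subgroup.mem_top _)
  have ho : IsOfFinOrder (⟨_, hmem⟩ : commutator K) := isOfFinOrder_of_finite _
  have ho' : IsOfFinOrder ⁅a, b⁆ := K.subtype.isOfFinOrder ((commutator K).subtype.isOfFinOrder ho)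
  have : ⁅a, b⁆ = 1 := eq_one_of_mem_fcCenter_of_isOfFinOrder hH
    (hK (⁅(⟨a, haK⟩ : K), (⟨b, hbK⟩ : K)⁆).2) ho'
  exact commutatorElement_eq_one_iff_commute.1 this

/-- A torsion-free abelian group embeds into its divisible hull, a rational vector space, where
unique sums are available. -/
theorem uniqueProds_of_isMulTorsionFree (A : Type*) [CommGroup A] [IsMulTorsionFree A] :
    UniqueProds A := by
  have h : UniqueSums (Additive A) := UniqueSums.of_injective_addHom
    (DivisibleHull.coeAddMonoidHom (M := Additive A)).toAddHom
    DivisibleHull.coe_injective inferInstance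
  exact UniqueProds.of_injective_mulHom (G := Multiplicative (Additive A))
    (MulEquiv.refl A : A ≃* A).toMulHom (MulEquiv.refl A).injective inferInstance

theorem uniqueProds_fcCenter (hH : NoNontrivialFiniteNormalSubgroup H) :
    UniqueProds (fcCenter H) := by
  let inst : CommGroup (fcCenter H) :=
    { (inferInstance : Group (fcCenter H)) with
      mul_comm := fun a b => Subtype.ext (commute_of_mem_fcCenter hH a.2 b.2) }
  have : IsMulTorsionFree (fcCenter H) := IsMulTorsionFree.of_not_isOfFinOrder fun a ha ho =>
    ha (Subtype.ext (eq_one_of_mem_fcCenter_of_isOfFinOrder hH a.2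
      ((fcCenter H).subtype.isOfFinOrder ho)))
  exact uniqueProds_of_isMulTorsionFree (fcCenter H)

/-- Given finitely many elements, some group element commutes with those that have finitely many
conjugates and moves the other ones out of a given finite set. -/
theorem exists_commute_and_conj_notMem (T A : Finset H) :
    ∃ x : H, (∀ t ∈ T, t ∈ fcCenter H → Commute x t) ∧
      ∀ t ∈ T, t ∉ fcCenter H → x * t * x⁻¹ ∉ A := by
  classical
  by_contra! hcon
  set T₁ := T.filter (· ∈ fcCenter H)
  -- Every element of `W` meets the first requirement, so by assumption each one conjugates some
  -- non-FC element of `T` into `A`.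
  set W : Subgroup H := ⨅ t ∈ T₁, Subgroup.centralizer {t}
  have hW : W.FiniteIndex := Subgroup.finiteIndex_iInf' _ fun t ht =>
    mem_fcCenter.1 (Finset.mem_filter.1 ht).2
  have hmemW {x : H} (hx : x ∈ W) : ∀ t ∈ T, t ∈ fcCenter H → Commute x t := by
    intro t ht htfc
    simp only [W, Subgroup.mem_iInf] at hx
    exact Subgroup.mem_centralizer_singleton_iff.1
      (hx t (Finset.mem_filter.2 ⟨ht, htfc⟩))
  let s : Finset (H × H) := (T.filter (· ∉ fcCenter H)) ×ˢ A
  -- The elements of `W` conjugating `p.1` to `p.2` form one left coset of the centralizer of `p.1`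
  -- in `W`, if there are any; `c p` represents it. The default `1` is never used in the covering
  -- argument.
  let c : H × H → W := fun p =>
    if h : ∃ x : W, (x : H) * p.1 * (x : H)⁻¹ = p.2 then h.choose else 1
  have hcov : ⋃ p ∈ s, c p • (((Subgroup.centralizer {p.1}).subgroupOf W : Subgroup W) : Set W)
      = Set.univ := by
    refine Set.eq_univ_of_forall fun x => ?_
    obtain ⟨t, ht, htfc, hxA⟩ := hcon x (hmemW x.2)
    simp only [Set.mem_iUnion]
    refine ⟨(t, x * t * (x : H)⁻¹), Finset.mk_mem_product (Finset.mem_filter.2 ⟨ht, htfc⟩) hxA, ?_⟩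
    have hex : ∃ y : W, (y : H) * t * (y : H)⁻¹ = x * t * (x : H)⁻¹ := ⟨x, rfl⟩
    have hc : c (t, x * t * (x : H)⁻¹) = hex.choose := dif_pos hex
    have hspec := hex.choose_spec
    rw [← hc] at hspec
    rw [Set.mem_smul_set_iff_inv_smul_mem]
    simp only [SetLike.mem_coe, Subgroup.mem_subgroupOf, Subgroup.mem_centralizer_singleton_iff,
      smul_eq_mul, Subgroup.coe_mul, Subgroup.coe_inv]
    generalize (c (t, x * t * (x : H)⁻¹) : H) = y at hspec
    calc y⁻¹ * x * t = y⁻¹ * (x * t * (x : H)⁻¹) * x := by group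
      _ = y⁻¹ * (y * t * y⁻¹) * x := by rw [hspec]
      _ = t * (y⁻¹ * x) := by group
  -- B. H. Neumann's lemma: in a finite covering by cosets, some subgroup has finite index. Here
  -- this makes a non-FC element FC.
  obtain ⟨p, hp, hfi⟩ := Subgroup.exists_finiteIndex_of_leftCoset_cover hcov
  refine (Finset.mem_filter.1 (Finset.mem_product.1 hp).1).2 (mem_fcCenter.2 ⟨fun h0 => ?_⟩)
  have h1 : ((Subgroup.centralizer {p.1}) ⊓ W).index ≠ 0 := by
    rw [← Subgroup.relIndex_mul_index (inf_le_right : (Subgroup.centralizer {p.1}) ⊓ W ≤ W)]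
    refine mul_ne_zero ?_ hW.index_ne_zero
    rw [Subgroup.inf_relIndex_right]
    exact hfi.index_ne_zero
  exact h1 (Nat.eq_zero_of_zero_dvd (h0 ▸ Subgroup.index_dvd_of_le inf_le_left))

end FCCenter

/-! ### Primeness tested on elements, and local units. -/

section ElementwisePrime

/-- If every element has a left local unit, primeness can be tested on elements. -/
theorem IsPrimeNonUnitalRing.eq_zero_or_eq_zero {S : Type*} [NonUnitalRing S]
    (hS : IsPrimeNonUnitalRing S) (hu : ∀ y : S, ∃ s, s * y = y) {a b : S}
    (hab : ∀ s, a * s * b = 0) : a = 0 ∨ b = 0 := by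
  by_contra! hne
  -- Annihilator ideals avoid describing the ideals generated by `a` and `b`: `J` contains `b`, and
  -- `I` below contains `a`.
  let J : TwoSidedIdeal S := TwoSidedIdeal.mk' {y | ∀ s, a * s * y = 0}
    (by simp) (fun hx hy s => by rw [mul_add, hx s, hy s, add_zero])
    (fun hx s => by rw [mul_neg, hx s, neg_zero])
    (fun {x y} hy s => by rw [← mul_assoc, mul_assoc a, hy])
    (fun {x y} hx s => by rw [← mul_assoc, hx s, zero_mul])
  have hJ (y : S) : y ∈ J ↔ ∀ s, a * s * y = 0 := TwoSidedIdeal.mem_mk' ..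
  let I : TwoSidedIdeal S := TwoSidedIdeal.mk' {x | ∀ y ∈ J, ∀ s, x * s * y = 0}
    (by simp) (fun hx hx' y hy s => by rw [add_mul, add_mul, hx y hy s, hx' y hy s, add_zero])
    (fun hx y hy s => by rw [neg_mul, neg_mul, hx y hy s, neg_zero])
    (fun {x x'} hx y hy s => by rw [mul_assoc x, mul_assoc x, hx y hy s, mul_zero])
    (fun {x x'} hx y hy s => by rw [mul_assoc x, hx y hy])
  have hI (x : S) : x ∈ I ↔ ∀ y ∈ J, ∀ s, x * s * y = 0 := TwoSidedIdeal.mem_mk' ..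
  refine hS ⟨I, J, ?_, ?_, ?_⟩
  · intro h
    exact hne.1 ((TwoSidedIdeal.mem_bot S).1 (h ▸ (hI a).2 fun y hy => (hJ y).1 hy))
  · intro h
    exact hne.2 ((TwoSidedIdeal.mem_bot S).1 (h ▸ (hJ b).2 hab))
  · intro x hx y hy
    obtain ⟨s, hs⟩ := hu y
    rw [← hs, ← mul_assoc]
    exact (hI x).1 hx y hy s

theorem IsPrimeNonUnitalRing.of_eq_zero_or_eq_zero {S : Type*} [NonUnitalRing S]
    (hS : ∀ a b : S, (∀ s, a * s * b = 0) → a = 0 ∨ b = 0) : IsPrimeNonUnitalRing S := by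
  rintro ⟨I, J, hI, hJ, hIJ⟩
  have key (K : TwoSidedIdeal S) (hK : K ≠ ⊥) : ∃ x ∈ K, x ≠ 0 := by
    by_contra! h
    exact hK (le_bot_iff.1 fun x hx => (TwoSidedIdeal.mem_bot S).2 (h x hx))
  obtain ⟨a, ha, ha0⟩ := key I hI
  obtain ⟨b, hb, hb0⟩ := key J hJ
  rcases hS a b fun s => hIJ _ (I.mul_mem_right _ _ ha) _ hb with h | h
  exacts [ha0 h, hb0 h]

theorem IsSUnitalRing.exists_left_unit {R : Type*} [NonUnitalRing R] (hR : IsSUnitalRing R)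
    (T : Finset R) : ∃ u : R, ∀ t ∈ T, u * t = t := by
  classical
  induction T using Finset.induction_on with
  | empty => exact ⟨0, by simp⟩
  | insert a T _ ih =>
    obtain ⟨u, hu⟩ := ih
    obtain ⟨v, hv⟩ := (hR (a - u * a)).1
    -- Formally `1 - (1 - v)(1 - u)`: the factor `1 - u` kills the old elements, and `1 - v` kills
    -- `a - u * a`.
    refine ⟨u + v - v * u, fun t ht => ?_⟩
    rcases Finset.mem_insert.1 ht with rfl | ht
    · calc (u + v - v * u) * t = u * t + v * (t - u * t) := by
            simp only [sub_mul, add_mul, mul_sub, mul_assoc]; abel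
        _ = t := by rw [hv]; abel
    · rw [sub_mul, add_mul, mul_assoc, hu t ht, add_sub_cancel_right]

end ElementwisePrime

/-! ### Connell's theorem for group rings with s-unital coefficients. -/

namespace NonUnitalGroupRing

variable {R : Type w} [NonUnitalRing R] {H : Type v} [Group H]

/-- The coefficient of a group ring element at a group element. -/
def coeff (k : H) : NonUnitalGroupRing R H →+ R := Finsupp.applyAddHom k

/-- The support of a group ring element. -/
def supp (x : NonUnitalGroupRing R H) : Finset H := Finsupp.support x

theorem mem_supp {x : NonUnitalGroupRing R H} {k : H} : k ∈ x.supp ↔ coeff k x ≠ 0 :=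
  Finsupp.mem_support_iff

theorem ext_coeff {x y : NonUnitalGroupRing R H} (h : ∀ k, coeff k x = coeff k y) : x = y :=
  Finsupp.ext h

theorem exists_coeff_ne_zero {x : NonUnitalGroupRing R H} (hx : x ≠ 0) : ∃ k, coeff k x ≠ 0 := by
  by_contra! h
  exact hx (ext_coeff fun k => (h k).trans (map_zero _).symm)

open Classical in
theorem coeff_single (k h : H) (a : R) : coeff k (single h a) = if h = k then a else 0 :=
  Finsupp.single_apply

theorem sum_supp_single (x : NonUnitalGroupRing R H) :
    ∑ h ∈ x.supp, single h (coeff h x) = x := Finsupp.sum_single x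

theorem coeff_single_mul (k h : H) (a : R) (y : NonUnitalGroupRing R H) :
    coeff k (single h a * y) = a * coeff (h⁻¹ * k) y := by
  classical
  induction y using NonUnitalGroupRing.induction with
  | h0 => simp
  | hadd y z hy hz => rw [mul_add, map_add, hy, hz, map_add, mul_add]
  | hs g b =>
    simp only [single_mul_single, coeff_single, eq_inv_mul_iff_mul_eq, mul_ite, mul_zero]

theorem coeff_mul_single (k h : H) (b : R) (x : NonUnitalGroupRing R H) :
    coeff k (x * single h b) = coeff (k * h⁻¹) x * b := by
  classical
  induction x using NonUnitalGroupRing.induction with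
  | h0 => simp
  | hadd y z hy hz => rw [add_mul, map_add, hy, hz, map_add, add_mul]
  | hs g a =>
    simp only [single_mul_single, coeff_single, eq_mul_inv_iff_mul_eq, ite_mul, zero_mul]

theorem coeff_mul (k : H) (x y : NonUnitalGroupRing R H) :
    coeff k (x * y) = ∑ h ∈ y.supp, coeff (k * h⁻¹) x * coeff h y := by
  conv_lhs => rw [← sum_supp_single y, Finset.mul_sum, map_sum]
  simp only [coeff_mul_single]

theorem coeff_mul_single_mul (k x : H) (r : R) (α β : NonUnitalGroupRing R H) :
    coeff k (α * single x r * β) =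
      ∑ h ∈ β.supp, coeff (k * h⁻¹ * x⁻¹) α * r * coeff h β := by
  rw [coeff_mul]
  simp only [coeff_mul_single]

theorem exists_left_unit (hR : IsSUnitalRing R) (y : NonUnitalGroupRing R H) :
    ∃ s, s * y = y := by
  classical
  obtain ⟨u, hu⟩ := hR.exists_left_unit (y.supp.image fun h => coeff h y)
  refine ⟨single 1 u, ext_coeff fun k => ?_⟩
  rw [coeff_single_mul, inv_one, one_mul]
  by_cases hk : coeff k y = 0
  · rw [hk, mul_zero]
  · exact hu _ (Finset.mem_image_of_mem _ (mem_supp.2 hk))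

theorem single_ne_zero {h : H} {a : R} (ha : a ≠ 0) : single h a ≠ 0 :=
  Finsupp.single_ne_zero.2 ha

theorem isPrime_coefficients (hR : IsSUnitalRing R)
    (hP : IsPrimeNonUnitalRing (NonUnitalGroupRing R H)) : IsPrimeNonUnitalRing R := by
  refine .of_eq_zero_or_eq_zero fun a b hab => ?_
  have h0 : ∀ s : NonUnitalGroupRing R H, single 1 a * s * single 1 b = 0 := by
    intro s
    refine ext_coeff fun k => ?_
    rw [coeff_mul_single, coeff_single_mul, hab, map_zero]
  refine (hP.eq_zero_or_eq_zero (exists_left_unit hR) h0).imp (fun h => ?_) (fun h => ?_)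
  · by_contra ha; exact single_ne_zero ha h
  · by_contra hb; exact single_ne_zero hb h

theorem noNontrivialFiniteNormalSubgroup_of_isPrime [Nontrivial R] (hR : IsSUnitalRing R)
    (hP : IsPrimeNonUnitalRing (NonUnitalGroupRing R H)) :
    NoNontrivialFiniteNormalSubgroup H := by
  classical
  intro N hN hfin
  have := Fintype.ofFinite N
  refine (Subgroup.eq_bot_iff_forall N).2 fun n hn => ?_
  obtain ⟨r, hr⟩ := exists_ne (0 : R)
  let x : NonUnitalGroupRing R H := ∑ m : N, single (m : H) r
  let y : NonUnitalGroupRing R H := single 1 r - single n r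
  have hx (k : H) : coeff k x = if k ∈ N then r else 0 := by
    simp only [x, map_sum, coeff_single]
    split_ifs with hk
    · rw [Finset.sum_eq_single ⟨k, hk⟩ (fun m _ hm => if_neg fun h => hm (Subtype.ext h))
        (by simp), if_pos rfl]
    · exact Finset.sum_eq_zero fun m _ => if_neg fun (h : (m : H) = k) => hk (h ▸ m.2)
  have hxy : ∀ s, x * s * y = 0 := by
    intro s
    induction s using NonUnitalGroupRing.induction with
    | h0 => simp
    | hadd s t hs ht => rw [mul_add, add_mul, hs, ht, add_zero]
    | hs g t =>
      refine ext_coeff fun k => ?_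
      simp only [y, mul_sub, map_sub, coeff_mul_single, hx, inv_one, mul_one, map_zero]
      -- Normality makes the two coefficients of `x`, coming from the two terms of `y`, agree and
      -- cancel.
      have : k * n⁻¹ * g⁻¹ ∈ N ↔ k * g⁻¹ ∈ N := by
        have h1 : k * n⁻¹ * g⁻¹ = (k * g⁻¹) * (g * n⁻¹ * g⁻¹) := by group
        rw [h1]
        exact N.mul_mem_cancel_right (hN.conj_mem _ (inv_mem hn) g)
      simp only [this, sub_self]
  rcases hP.eq_zero_or_eq_zero (exists_left_unit hR) hxy with h | h
  · have := hx 1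
    rw [h, map_zero, if_pos (one_mem N)] at this
    exact absurd this.symm hr
  · by_contra hn1
    have : coeff (1 : H) y = r := by
      simp only [y, map_sub, coeff_single, if_true, if_neg hn1, sub_zero]
    rw [h, map_zero] at this
    exact hr this.symm

/-- Passman's reduction to the subgroup of elements with finitely many conjugates. -/
theorem sum_fcCenter_eq_zero {α β : NonUnitalGroupRing R H}
    (hαβ : ∀ s, α * s * β = 0) (k : H) (r : R) [DecidablePred (· ∈ fcCenter H)] :
    ∑ h ∈ β.supp with k * h⁻¹ ∈ fcCenter H, coeff (k * h⁻¹) α * r * coeff h β = 0 := by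
  classical
  -- In the coefficient of `α * single x r * β` at `x * k`, the left factor is read at `x (k h⁻¹)
  -- x⁻¹`. This `x` fixes the FC-elements `k h⁻¹` and moves the others off the support of `α`.
  obtain ⟨x, hx1, hx2⟩ :=
    exists_commute_and_conj_notMem (β.supp.image fun h => k * h⁻¹) α.supp
  have h0 := congrArg (coeff (x * k)) (hαβ (single x r))
  rw [coeff_mul_single_mul, map_zero] at h0
  rw [Finset.sum_filter]
  refine Eq.trans (Finset.sum_congr rfl fun h hh => ?_) h0
  have hmem := Finset.mem_image_of_mem (fun h => k * h⁻¹) hh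
  have hassoc : x * k * h⁻¹ * x⁻¹ = x * (k * h⁻¹) * x⁻¹ := by group
  rw [hassoc]
  split_ifs with hfc
  · rw [(hx1 _ hmem hfc).eq, mul_inv_cancel_right]
  · have := hx2 _ hmem hfc
    rw [mem_supp, not_not] at this
    rw [this, zero_mul, zero_mul]

/-- Connell's theorem, sufficiency. -/
theorem isPrime_of_noNontrivialFiniteNormalSubgroup (hR : IsSUnitalRing R)
    (hP : IsPrimeNonUnitalRing R) (hH : NoNontrivialFiniteNormalSubgroup H) :
    IsPrimeNonUnitalRing (NonUnitalGroupRing R H) := by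
  classical
  refine .of_eq_zero_or_eq_zero fun α β hαβ => ?_
  by_contra! hne
  obtain ⟨a₀, ha₀⟩ := exists_coeff_ne_zero hne.1
  obtain ⟨b₀, hb₀⟩ := exists_coeff_ne_zero hne.2
  have hUP := uniqueProds_fcCenter hH
  have hcover (γ : NonUnitalGroupRing R H) (f : fcCenter H → H) (hf : f.Injective) :
      ∃ A : Finset (fcCenter H), ∀ d, d ∈ A ↔ coeff (f d) γ ≠ 0 :=
    ⟨γ.supp.preimage f hf.injOn, fun d => by rw [Finset.mem_preimage, mem_supp]⟩
  -- `A` and `B` record the supports of `α` and `β` in the FC-center cosets of `a₀` and `b₀`,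
  -- shifted so that both contain `1`.
  obtain ⟨A, hA⟩ := hcover α (fun d => a₀ * d)
    ((mul_right_injective a₀).comp Subtype.val_injective)
  obtain ⟨B, hB⟩ := hcover β (fun d => d * b₀)
    ((mul_left_injective b₀).comp Subtype.val_injective)
  obtain ⟨a, haA, b, hbB, hab⟩ := hUP.uniqueMul_of_nonempty
    (A := A) (B := B) ⟨1, (hA 1).2 (by simpa using ha₀)⟩ ⟨1, (hB 1).2 (by simpa using hb₀)⟩
  -- apply the reduction to the left translate of `α` by `a₀⁻¹`
  have hred (r : R) : coeff (a₀ * a) α * r * coeff (b * b₀) β = 0 := by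
    obtain ⟨u, hu⟩ := hR.exists_left_unit (α.supp.image fun h => coeff h α)
    have hα' (k : H) : coeff k (single a₀⁻¹ u * α) = coeff (a₀ * k) α := by
      rw [coeff_single_mul, inv_inv]
      by_cases hk : coeff (a₀ * k) α = 0
      · rw [hk, mul_zero]
      · exact hu _ (Finset.mem_image_of_mem _ (mem_supp.2 hk))
    -- At `k = a b b₀`, a nonzero term yields elements `a b b₀ h⁻¹` of `A` and `h b₀⁻¹` of `B` with
    -- product `a b`. Uniqueness leaves only `h = b b₀`.
    have h0 := sum_fcCenter_eq_zero (α := single a₀⁻¹ u * α) (β := β)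
      (fun s => by rw [mul_assoc (single a₀⁻¹ u), mul_assoc (single a₀⁻¹ u), hαβ, mul_zero])
      (a * b * b₀) r
    have hbb : (a : H) * b * b₀ * (b * b₀ : H)⁻¹ = a := by group
    rw [Finset.sum_eq_single (b * b₀ : H), hα', hbb] at h0
    · exact h0
    · intro h hh hne'
      obtain ⟨hhβ, hfc⟩ := Finset.mem_filter.1 hh
      rw [hα']
      by_contra hnz
      have hb' : h * b₀⁻¹ ∈ fcCenter H := by
        have : h * b₀⁻¹ = ((a : H) * b * b₀ * h⁻¹)⁻¹ * (a * b) := by group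
        rw [this]
        exact mul_mem (inv_mem hfc) (mul_mem a.2 b.2)
      have h1 : (⟨_, hfc⟩ : fcCenter H) ∈ A := (hA _).2 fun h => hnz (by
        rw [h, zero_mul, zero_mul])
      have h2 : (⟨_, hb'⟩ : fcCenter H) ∈ B := (hB _).2 (by
        simpa only [inv_mul_cancel_right] using mem_supp.1 hhβ)
      have h3 := (hab h1 h2 (Subtype.ext (by
        simp only [Subgroup.coe_mul]; group))).2
      exact hne' (by rw [← h3]; simp)
    · intro hnot
      exact absurd (Finset.mem_filter.2 ⟨mem_supp.2 ((hB b).1 hbB), hbb.symm ▸ a.2⟩) hnot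
  rcases hP.eq_zero_or_eq_zero (fun y => (hR y).1) hred with h | h
  exacts [(hA a).1 haA h, (hB b).1 hbB h]

theorem isPrime_iff [Nontrivial R] (hR : IsSUnitalRing R) :
    IsPrimeNonUnitalRing (NonUnitalGroupRing R H) ↔
      IsPrimeNonUnitalRing R ∧ NoNontrivialFiniteNormalSubgroup H :=
  ⟨fun h => ⟨isPrime_coefficients hR h, noNontrivialFiniteNormalSubgroup_of_isPrime hR h⟩,
    fun h => isPrime_of_noNontrivialFiniteNormalSubgroup hR h.1 h.2⟩

end NonUnitalGroupRing

/-! ### Groupoid rings and their isotropy corners. -/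

namespace GroupoidMor

variable {G : Type u} [Groupoid.{v} G]

theorem comp_left_injective {g h h' : GroupoidMor G} {p : g.s = h.r} {p' : g.s = h'.r}
    (heq : g.comp h p = g.comp h' p') : h = h' := by
  obtain ⟨s, r, g⟩ := g
  obtain ⟨t, _, h⟩ := h
  obtain ⟨t', _, h'⟩ := h'
  dsimp only at p p'
  subst p p'
  simp only [comp, eqToHom_refl, Category.id_comp, mk.injEq, true_and] at heq
  obtain ⟨rfl, heq⟩ := heq
  rw [(cancel_mono g).1 (eq_of_heq heq)]

theorem comp_right_injective {g g' h : GroupoidMor G} {p : g.s = h.r} {p' : g'.s = h.r}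
    (heq : g.comp h p = g'.comp h p') : g = g' := by
  obtain ⟨s, r, g⟩ := g
  obtain ⟨_, r', g'⟩ := g'
  obtain ⟨t, _, h⟩ := h
  dsimp only at p p'
  subst p p'
  simp only [comp, eqToHom_refl, Category.id_comp, mk.injEq, true_and] at heq
  obtain ⟨rfl, heq⟩ := heq
  rw [(cancel_epi h).1 (eq_of_heq heq)]

theorem id_comp (g : GroupoidMor G) : comp ⟨g.r, g.r, 𝟙 g.r⟩ g rfl = g := by
  simp [comp]

end GroupoidMor

namespace GroupoidRing

variable {R : Type w} [NonUnitalRing R] {G : Type u} [Groupoid.{v} G]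

/-- The coefficient of a groupoid ring element at a morphism. -/
def coeff (g : GroupoidMor G) : GroupoidRing R G →+ R := Finsupp.applyAddHom g

theorem exists_coeff_ne_zero {x : GroupoidRing R G} (hx : x ≠ 0) : ∃ g, coeff g x ≠ 0 := by
  by_contra! h
  exact hx (Finsupp.ext h)

open Classical in
theorem coeff_single (k g : GroupoidMor G) (a : R) :
    coeff k (single g a) = if g = k then a else 0 := Finsupp.single_apply

theorem single_ne_zero {g : GroupoidMor G} {a : R} (ha : a ≠ 0) : single g a ≠ 0 :=
  Finsupp.single_ne_zero.2 ha

theorem coeff_single_mul (p g : GroupoidMor G) (h : p.s = g.r) (a : R) (x : GroupoidRing R G) :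
    coeff (p.comp g h) (single p a * x) = a * coeff g x := by
  classical
  induction x using GroupoidRing.induction with
  | h0 => simp
  | hadd y z hy hz => rw [mul_add, map_add, hy, hz, map_add, mul_add]
  | hs k b =>
    by_cases hk : p.s = k.r
    · rw [single_mul_single_of_eq _ _ hk, coeff_single, coeff_single]
      by_cases hkg : k = g
      · subst hkg; simp
      · rw [if_neg hkg, if_neg fun he => hkg (GroupoidMor.comp_left_injective he), mul_zero]
    · rw [single_mul_single_of_ne _ _ hk, coeff_single, if_neg, map_zero, mul_zero]
      rintro rfl
      exact hk h

theorem coeff_mul_single (g q : GroupoidMor G) (h : g.s = q.r) (b : R) (x : GroupoidRing R G) :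
    coeff (g.comp q h) (x * single q b) = coeff g x * b := by
  classical
  induction x using GroupoidRing.induction with
  | h0 => simp
  | hadd y z hy hz => rw [add_mul, map_add, hy, hz, map_add, add_mul]
  | hs k a =>
    by_cases hk : k.s = q.r
    · rw [single_mul_single_of_eq _ _ hk, coeff_single, coeff_single]
      by_cases hkg : k = g
      · subst hkg; simp
      · rw [if_neg hkg, if_neg fun he => hkg (GroupoidMor.comp_right_injective he), zero_mul]
    · rw [single_mul_single_of_ne _ _ hk, coeff_single, if_neg, map_zero, zero_mul]
      rintro rfl
      exact hk h

/-- Only finitely many ranges and coefficients occur in `y`, so it suffices to sum `u δ_f` over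
identities at those ranges, with `u` a common left unit of the coefficients. -/
theorem exists_left_unit (hR : IsSUnitalRing R) (y : GroupoidRing R G) : ∃ s, s * y = y := by
  classical
  let S : Finset (GroupoidMor G) := Finsupp.support y
  have hy : ∑ g ∈ S, single g (coeff g y) = y := Finsupp.sum_single y
  obtain ⟨u, hu⟩ := hR.exists_left_unit (S.image fun g => coeff g y)
  refine ⟨∑ f ∈ S.image GroupoidMor.r, single ⟨f, f, 𝟙 f⟩ u, ?_⟩
  conv_lhs => rw [← hy]
  conv_rhs => rw [← hy]
  rw [Finset.mul_sum]
  refine Finset.sum_congr rfl fun g hg => ?_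
  rw [Finset.sum_mul, Finset.sum_eq_single g.r]
  · rw [single_mul_single_of_eq _ _ rfl, GroupoidMor.id_comp,
      hu _ (Finset.mem_image_of_mem _ hg)]
  · exact fun f _ hf => single_mul_single_of_ne _ _ hf _ _
  · exact fun h => absurd (Finset.mem_image_of_mem _ hg) h

/-- The embedding of the group ring of an isotropy group into the groupoid ring. -/
noncomputable def ofIsotropy (e : G) : NonUnitalGroupRing R (Isotropy e) →+ GroupoidRing R G :=
  Finsupp.mapDomain.addMonoidHom fun h : Isotropy e => (⟨e, e, h⟩ : GroupoidMor G)

theorem ofIsotropy_injective (e : G) :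
    Function.Injective (ofIsotropy e : NonUnitalGroupRing R (Isotropy e) →+ GroupoidRing R G) :=
  Finsupp.mapDomain_injective fun _ _ h => by simpa using h

theorem ofIsotropy_single (e : G) (h : Isotropy e) (a : R) :
    ofIsotropy e (NonUnitalGroupRing.single h a) = single ⟨e, e, h⟩ a :=
  Finsupp.mapDomain_single

theorem ofIsotropy_mul (e : G) (x y : NonUnitalGroupRing R (Isotropy e)) :
    ofIsotropy e (x * y) = ofIsotropy e x * ofIsotropy e y := by
  induction x using NonUnitalGroupRing.induction with
  | h0 => simp
  | hadd x x' hx hx' => simp only [add_mul, map_add, hx, hx']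
  | hs g a =>
  induction y using NonUnitalGroupRing.induction with
  | h0 => simp
  | hadd y y' hy hy' => simp only [mul_add, map_add, hy, hy']
  | hs h b =>
    rw [NonUnitalGroupRing.single_mul_single]
    simp only [ofIsotropy_single]
    rw [single_mul_single_of_eq _ _ rfl]
    simp [GroupoidMor.comp, End.mul_def]

theorem ofIsotropy_mul_single_of_ne {e : G} (x : NonUnitalGroupRing R (Isotropy e))
    (g : GroupoidMor G) (hg : g.r ≠ e) (a : R) : ofIsotropy e x * single g a = 0 := by
  induction x using NonUnitalGroupRing.induction with
  | h0 => simp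
  | hadd x x' hx hx' => simp only [add_mul, map_add, hx, hx', add_zero]
  | hs h b => rw [ofIsotropy_single, single_mul_single_of_ne _ _ (Ne.symm hg)]

theorem single_mul_ofIsotropy_of_ne {e : G} (x : NonUnitalGroupRing R (Isotropy e))
    (g : GroupoidMor G) (hg : g.s ≠ e) (a : R) : single g a * ofIsotropy e x = 0 := by
  induction x using NonUnitalGroupRing.induction with
  | h0 => simp
  | hadd x x' hx hx' => simp only [mul_add, map_add, hx, hx', add_zero]
  | hs h b => rw [ofIsotropy_single, single_mul_single_of_ne _ _ hg]

/-- Between two elements of the corner at `e`, only the part of `s` supported on `G_e^e` survives.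
-/
theorem ofIsotropy_mul_mul_eq_zero_iff {e : G} (x y : NonUnitalGroupRing R (Isotropy e)) :
    (∀ s, ofIsotropy e x * s * ofIsotropy e y = 0) ↔ ∀ s, x * s * y = 0 := by
  refine ⟨fun h s => ofIsotropy_injective e ?_, fun h s => ?_⟩
  · rw [ofIsotropy_mul, ofIsotropy_mul, h, map_zero]
  · induction s using GroupoidRing.induction with
    | h0 => simp
    | hadd s t hs ht => rw [mul_add, add_mul, hs, ht, add_zero]
    | hs g a =>
      by_cases hr : g.r = e
      · by_cases hs : g.s = e
        · obtain ⟨s, r, g⟩ := g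
          dsimp only at hr hs
          subst hr hs
          rw [← ofIsotropy_single, ← ofIsotropy_mul, ← ofIsotropy_mul, h, map_zero]
        · rw [mul_assoc, single_mul_ofIsotropy_of_ne y g hs, mul_zero]
      · rw [ofIsotropy_mul_single_of_ne x g hr, zero_mul]

theorem exists_ofIsotropy_eq {e f f' : G} (p : f ⟶ e) (q : e ⟶ f') (a b : R)
    (x : GroupoidRing R G) :
    ∃ y, ofIsotropy e y = single ⟨f, e, p⟩ a * x * single ⟨e, f', q⟩ b := by
  induction x using GroupoidRing.induction with
  | h0 => exact ⟨0, by simp⟩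
  | hadd x x' hx hx' =>
    obtain ⟨y, hy⟩ := hx
    obtain ⟨y', hy'⟩ := hx'
    exact ⟨y + y', by rw [map_add, hy, hy', mul_add, add_mul]⟩
  | hs g c =>
    by_cases hr : f = g.r
    · by_cases hs : g.s = f'
      · exact ⟨NonUnitalGroupRing.single _ _, by
          rw [single_mul_single_of_eq _ _ hr, single_mul_single_of_eq _ _ hs, ofIsotropy_single]
          rfl⟩
      · exact ⟨0, by rw [mul_assoc, single_mul_single_of_ne _ _ hs, mul_zero, map_zero]⟩
    · exact ⟨0, by rw [single_mul_single_of_ne _ _ hr, zero_mul, map_zero]⟩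

theorem connected_of_isPrime [Nontrivial R] (hR : IsSUnitalRing R)
    (hP : IsPrimeNonUnitalRing (GroupoidRing R G)) : GroupoidConnected G := by
  intro e f
  by_contra hef
  obtain ⟨a, ha⟩ := exists_ne (0 : R)
  have h0 : ∀ s : GroupoidRing R G, single ⟨f, f, 𝟙 f⟩ a * s * single ⟨e, e, 𝟙 e⟩ a = 0 := by
    intro s
    induction s using GroupoidRing.induction with
    | h0 => simp
    | hadd s t hs ht => rw [mul_add, add_mul, hs, ht, add_zero]
    | hs g b =>
      by_cases hr : f = g.r
      · have hs : ¬ g.s = e := by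
          rintro rfl
          subst hr
          exact hef ⟨g.hom⟩
        rw [mul_assoc, single_mul_single_of_ne _ _ hs, mul_zero]
      · rw [single_mul_single_of_ne _ _ hr, zero_mul]
  rcases hP.eq_zero_or_eq_zero (exists_left_unit hR) h0 with h | h
  exacts [single_ne_zero ha h, single_ne_zero ha h]

theorem isPrime_isotropy (hR : IsSUnitalRing R) (hP : IsPrimeNonUnitalRing (GroupoidRing R G))
    (e : G) : IsPrimeNonUnitalRing (NonUnitalGroupRing R (Isotropy e)) := by
  refine .of_eq_zero_or_eq_zero fun x y hxy => ?_
  exact (hP.eq_zero_or_eq_zero (exists_left_unit hR)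
    ((ofIsotropy_mul_mul_eq_zero_iff x y).2 hxy)).imp
    (fun h => ofIsotropy_injective e (h.trans (map_zero _).symm))
    (fun h => ofIsotropy_injective e (h.trans (map_zero _).symm))

/-- For `g` in the support of `x`, connectedness supplies `p`, `q` making `p g q` a loop at `e`.
Left and right units of the coefficient at `g` carry it unchanged to that loop, so the result is
nonzero. -/
theorem exists_ofIsotropy_ne_zero (hR : IsSUnitalRing R) (hG : GroupoidConnected G) (e : G)
    {x : GroupoidRing R G} (hx : x ≠ 0) :
    ∃ s t y, ofIsotropy e y = s * x * t ∧ y ≠ 0 := by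
  obtain ⟨g, hg⟩ := exists_coeff_ne_zero hx
  obtain ⟨p⟩ := hG g.r e
  obtain ⟨q⟩ := hG e g.s
  obtain ⟨u, hu⟩ := (hR (coeff g x)).1
  obtain ⟨v, hv⟩ := (hR (coeff g x)).2
  obtain ⟨y, hy⟩ := exists_ofIsotropy_eq p q u v x
  refine ⟨_, _, y, hy, ?_⟩
  rintro rfl
  have h := coeff_mul_single (GroupoidMor.comp ⟨g.r, e, p⟩ g rfl) ⟨e, g.s, q⟩ rfl v
    (single ⟨g.r, e, p⟩ u * x)
  rw [← hy, map_zero, map_zero, coeff_single_mul, hu, hv] at h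
  exact hg h.symm

theorem isPrime_of_isPrime_isotropy (hR : IsSUnitalRing R) (hG : GroupoidConnected G) (e : G)
    (hP : IsPrimeNonUnitalRing (NonUnitalGroupRing R (Isotropy e))) :
    IsPrimeNonUnitalRing (GroupoidRing R G) := by
  refine .of_eq_zero_or_eq_zero fun α β hαβ => ?_
  by_contra! hne
  obtain ⟨s, t, x, hx, hx0⟩ := exists_ofIsotropy_ne_zero hR hG e hne.1
  obtain ⟨s', t', y, hy, hy0⟩ := exists_ofIsotropy_ne_zero hR hG e hne.2
  have hxy : ∀ z, x * z * y = 0 := by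
    refine (ofIsotropy_mul_mul_eq_zero_iff x y).1 fun z => ?_
    rw [hx, hy]
    calc s * α * t * z * (s' * β * t') = s * (α * (t * z * s') * β) * t' := by
          simp only [mul_assoc]
      _ = 0 := by rw [hαβ, mul_zero, zero_mul]
  rcases hP.eq_zero_or_eq_zero (NonUnitalGroupRing.exists_left_unit hR) hxy with h | h
  exacts [hx0 h, hy0 h]

end GroupoidRing

theorem mainTheorem8 {R : Type w} [NonUnitalRing R] [Nontrivial R] (hR : IsSUnitalRing R)
    {G : Type u} [Groupoid.{v} G] [Nonempty G] :
    List.TFAE [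
      IsPrimeNonUnitalRing (GroupoidRing R G),
      GroupoidConnected G ∧
        ∃ e : G, IsPrimeNonUnitalRing (NonUnitalGroupRing R (Isotropy e)),
      GroupoidConnected G ∧
        ∀ e : G, IsPrimeNonUnitalRing (NonUnitalGroupRing R (Isotropy e)),
      GroupoidConnected G ∧ IsPrimeNonUnitalRing R ∧
        ∃ e : G, NoNontrivialFiniteNormalSubgroup (Isotropy e),
      GroupoidConnected G ∧ IsPrimeNonUnitalRing R ∧
        ∀ e : G, NoNontrivialFiniteNormalSubgroup (Isotropy e)] := by
  tfae_have 1 → 3 := fun h =>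
    ⟨GroupoidRing.connected_of_isPrime hR h, GroupoidRing.isPrime_isotropy hR h⟩
  tfae_have 3 → 2 := fun ⟨hG, h⟩ => ⟨hG, ‹Nonempty G›.elim fun e => ⟨e, h e⟩⟩
  tfae_have 2 → 1 := fun ⟨hG, e, h⟩ => GroupoidRing.isPrime_of_isPrime_isotropy hR hG e h
  tfae_have 2 ↔ 4 := by
    simp only [NonUnitalGroupRing.isPrime_iff hR, exists_and_left]
  tfae_have 3 ↔ 5 := by
    -- Pulling primeness of `R` out of the quantifier over objects needs `G` to be non-empty.
    simp only [NonUnitalGroupRing.isPrime_iff hR, forall_and, forall_const]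
  tfae_finish
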